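/- **Setting.** Let $N$ models in $\mathbb R^p$ be trained by DP-SGD for $T$ steps and merged with weights $\lambda=(\lambda_1,\dots,\lambda_N)$ in the probability simplex. Step $t$ has, for each run $i$, a sampling ratio $q_i^{(t)}\in[0,1]$, a learning rate $\eta_i^{(t)}\ge0$, a clipping threshold $C_i^{(t)}\ge 0$, a noise multiplier $\sigma_i^{(t)}\ge0$, and per-record gradients $g_i^{(t)}(\theta;x)\in\mathbb R^p$. On a finite dataset, run $i$ includes each record in its mini-batch independently with probability $q_i^{(t)}$ (independently over runs), lets $\tilde g_i^{(t)}$ be the sum over the mini-batch of $\mathrm{clip}\big(g_i^{(t)}(\theta_i^{(t-1)};x),C_i^{(t)}\big)$, where $\mathrm{clip}(g,C)=\min(1,C/\|g\|_2)\,g$ and $\mathrm{clip}(0,C)=0$, and updates $\theta_i^{(t)}=\theta_i^{(t-1)}-\eta_i^{(t)}(\tilde g_i^{(t)}+e_i^{(t)})$ with independent noise $e_i^{(t)}\sim\mathcal N(0,(\sigma_i^{(t)}C_i^{(t)})^2I)$, independent of the sampling. The merged model is $\theta^{(t)}=\sum_i\lambda_i\theta_i^{(t)}$. Put $$\rho_J^{(t)}=\prod_{i\in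 J}q_i^{(t)}\prod_{i\notin J}(1-q_i^{(t)}),\qquad \Delta_J^{(t)}=\sum_{i\in J}\lambda_i\eta_i^{(t)}C_i^{(t)}\quad(J\subseteq[N]),\qquad (s_\lambda^{(t)})^2=\sum_{i=1}^N(\lambda_i\eta_i^{(t)}\sigma_i^{(t)}C_i^{(t)})^2,$$ and assume $s_\lambda^{(t)}>0$. Write $\phi(\cdot;\mu,\Sigma)$ for the Gaussian density, $x_+=\max(x,0)$, and $\mathcal H_\varepsilon(P,Q)=\sup_S\{P(S)-e^\varepsilon Q(S)\}$, the supremum being over measurable $S$. Let $D$ be a dataset, let $D'$ be $D$ with one record removed, and fix the iterates $\theta_1^{(t-1)},\dots,\theta_N^{(t-1)}$ before step $t$. Let $P^{(t)},Q^{(t)}$ be the conditional laws of $\theta^{(t)}-\theta^{(t-1)}$ under $D$ and $D'$ given these iterates, and let $L^{(t)}=\log\frac{dP^{(t)}}{dQ^{(t)}}(Y)$ with $Y\sim Q^{(t)}$ be the privacy loss. Define the surrogate privacy loss $$\tilde L^{(t)}=\log\frac{\sum_{J\subseteq[N]}\rho_J^{(t)}\,\phi\big(Z;\Delta_J^{(t)},(s_\lambda^{(t)})^2\big)}{\phi\big(Z;0,(s_\lambda^{(t)})^2\big)},\qquad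 Z\sim\mathcal N\big(0,(s_\lambda^{(t)})^2\big).$$ **Theorem.** The variables $e^{L^{(t)}}$ and $e^{\tilde L^{(t)}}$ are integrable and, for every $\varepsilon\ge0$, $$\mathcal H_\varepsilon(P^{(t)},Q^{(t)})=\mathbb E\big[(e^{L^{(t)}}-e^\varepsilon)_+\big]\le\mathbb E\big[(e^{\tilde L^{(t)}}-e^\varepsilon)_+\big],$$ $$\mathcal H_\varepsilon(Q^{(t)},P^{(t)})=\mathbb E\big[(1-e^{\varepsilon+L^{(t)}})_+\big]\le\mathbb E\big[(1-e^{\varepsilon+\tilde L^{(t)}})_+\big].$$ The same holds when $P^{(t)}$ and $Q^{(t)}$ are the laws conditional also on the choice at step $t$ of the mini-batches among the records common to $D$ and $D'$. In that case, let $m$ be the mean of $Q^{(t)}$, and let $v_J^{(t)}$ be the difference between the conditional mean under $D$, given that exactly the runs in $J$ include the differing record, and $m$. Then the privacy loss is, almost surely, $$L^{(t)}=\log\frac{\sum_{J\subseteq[N]}\rho_J^{(t)}\,\phi\big(Y-m;v_J^{(t)},(s_\lambda^{(t)})^2I\big)}{\phi\big(Y-m;0,(s_\lambda^{(t)})^2I\big)},\qquad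 Y\sim Q^{(t)}.$$ -/

import Mathlib

open MeasureTheory ProbabilityTheory

noncomputable section

/-- The model space `ℝ^p` with its Euclidean norm. -/
abbrev Param (p : ℕ) : Type := EuclideanSpace ℝ (Fin p)

/-- The hockey-stick divergence `H_ε(P, Q) = sup_S (P(S) - e^ε Q(S))`, over measurable `S`.
For probability measures the supremum is over a nonempty set bounded by `1`. -/
def hockeyStick {Ω : Type*} [MeasurableSpace Ω] (ε : ℝ) (P Q : Measure Ω) : ℝ :=
  ⨆ S : {S : Set Ω // MeasurableSet S}, (P.real S.1 - Real.exp ε * Q.real S.1)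

/-- `E[(e^ℓ - e^ε)_+]` for the random variable `ℓ = loss Y`, `Y ∼ μ`. -/
def expectedExcess {Ω : Type*} [MeasurableSpace Ω] (μ : Measure Ω) (loss : Ω → ℝ) (ε : ℝ) : ℝ :=
  ∫ y, max (Real.exp (loss y) - Real.exp ε) 0 ∂μ

/-- `E[(1 - e^{ε + ℓ})_+]` for the random variable `ℓ = loss Y`, `Y ∼ μ`. -/
def expectedDeficit {Ω : Type*} [MeasurableSpace Ω] (μ : Measure Ω) (loss : Ω → ℝ) (ε : ℝ) : ℝ :=
  ∫ y, max (1 - Real.exp (ε + loss y)) 0 ∂μ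

/-- Clipping to norm at most `c`: `clip(g, c) = min(1, c / ‖g‖) g`, with `clip(0, c) = 0`. -/
def clip {p : ℕ} (g : Param p) (c : ℝ) : Param p := min 1 (c / ‖g‖) • g

/-- The density at `y` of the Gaussian `N(μ, v I)` on `ℝ^p`. -/
def isoGaussianPDF {p : ℕ} (y μ : Param p) (v : ℝ) : ℝ :=
  (Real.sqrt (2 * Real.pi * v))⁻¹ ^ p * Real.exp (-‖y - μ‖ ^ 2 / (2 * v))

/-- The Gaussian measure `N(0, c² I)` on `ℝ^p`. -/
def isoGaussian (p : ℕ) (c : ℝ) : Measure (Param p) :=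
  (stdGaussian (Param p)).map (fun x => c • x)

/-- `N` DP-SGD runs of `T` steps on records of type `X`, merged by a linear combination. -/
structure LinMixDPSGD (N p T : ℕ) (X : Type*) where
  /-- mixing weights -/
  lam : Fin N → ℝ
  lam_mem : lam ∈ stdSimplex ℝ (Fin N)
  /-- sampling ratios -/
  q : Fin T → Fin N → ℝ
  q_mem : ∀ t i, q t i ∈ Set.Icc (0 : ℝ) 1
  /-- learning rates -/
  eta : Fin T → Fin N → ℝ
  eta_nonneg : ∀ t i, 0 ≤ eta t i
  /-- clipping thresholds -/
  C : Fin T → Fin N → ℝ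
  C_nonneg : ∀ t i, 0 ≤ C t i
  /-- noise multipliers -/
  sigma : Fin T → Fin N → ℝ
  sigma_nonneg : ∀ t i, 0 ≤ sigma t i
  /-- `grad t i θ x` is the gradient that run `i` computes at step `t` from the record `x`
  at its current iterate `θ` -/
  grad : Fin T → Fin N → Param p → X → Param p

namespace LinMixDPSGD

variable {N p T : ℕ} {X : Type*} (M : LinMixDPSGD N p T X) (t : Fin T)

/-- The probability `ρ_J` that a given record is in the mini-batches of exactly the runs in `J`. -/
def rho (J : Finset (Fin N)) : ℝ := (∏ i ∈ J, M.q t i) * ∏ i ∈ Jᶜ, (1 - M.q t i)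

/-- The variance `s_λ²` of the aggregated noise. -/
def noiseVar : ℝ := ∑ i, (M.lam i * M.eta t i * M.sigma t i * M.C t i) ^ 2

/-- The clipping-weighted mixing coefficient `w_i`. -/
def w (i : Fin N) : ℝ := M.lam i * M.eta t i * M.C t i

/-- The shift size `Δ_J`. -/
def Delta (J : Finset (Fin N)) : ℝ := ∑ i ∈ J, M.w t i

/-- The sum of the clipped per-record gradients over the mini-batch of run `i`. A choice of
mini-batches is recorded by `z : Fin N → Fin n → Bool`: record `k` of `D` is in the mini-batch
of run `i` iff `z i k = true`. -/
def clippedGrad {n : ℕ} (θ : Fin N → Param p) (D : Fin n → X) (z : Fin N → Fin n → Bool)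
    (i : Fin N) : Param p :=
  ∑ k, if z i k then clip (M.grad t i (θ i) (D k)) (M.C t i) else 0

/-- The iterate of run `i` after step `t`, for mini-batches `z` and noise vectors `e`. -/
def nextIterate {n : ℕ} (θ : Fin N → Param p) (D : Fin n → X) (z : Fin N → Fin n → Bool)
    (e : Fin N → Param p) (i : Fin N) : Param p :=
  θ i - M.eta t i • (M.clippedGrad t θ D z i + e i)

/-- The change of the merged model `∑ i, λ_i θ_i` during step `t`. -/
def increment {n : ℕ} (θ : Fin N → Param p) (D : Fin n → X) (z : Fin N → Fin n → Bool)
    (e : Fin N → Param p) : Param p :=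
  (∑ i, M.lam i • M.nextIterate t θ D z e i) - ∑ i, M.lam i • θ i

/-- The law of the noise vectors: independent over the runs, `e_i ∼ N(0, (σ_i C_i)² I)`. -/
def noiseLaw : Measure (Fin N → Param p) :=
  Measure.pi fun i => isoGaussian p (M.sigma t i * M.C t i)

/-- The law of the increment given the mini-batches `z`. -/
def incrementLaw {n : ℕ} (θ : Fin N → Param p) (D : Fin n → X) (z : Fin N → Fin n → Bool) :
    Measure (Param p) :=
  (M.noiseLaw t).map (M.increment t θ D z)

/-- The probability of the mini-batches `z` when run `i` includes each record independently with
probability `q_i`, independently over the runs. -/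
def selectionProb {n : ℕ} (z : Fin N → Fin n → Bool) : ℝ :=
  ∏ i, ∏ k, if z i k then M.q t i else 1 - M.q t i

/-- The law of the increment on the dataset `D`, given the iterates `θ` before step `t`. -/
def stepLaw {n : ℕ} (θ : Fin N → Param p) (D : Fin n → X) : Measure (Param p) :=
  ∑ z : Fin N → Fin n → Bool, ENNReal.ofReal (M.selectionProb t z) • M.incrementLaw t θ D z

/-- The mini-batches whose selection among the records other than record `j` is `b`, and where
record `j` is included exactly by the runs in `J`. -/
def withRecord {n : ℕ} (j : Fin (n + 1)) (b : Fin N → Fin n → Bool) (J : Finset (Fin N)) :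
    Fin N → Fin (n + 1) → Bool :=
  fun i => Fin.insertNth (α := fun _ => Bool) j (decide (i ∈ J)) (b i)

/-- The law of the increment on `D`, given the iterates before step `t` and given the selection
`b` among the records other than record `j`; the inclusion of record `j` remains random. -/
def stepLawGiven {n : ℕ} (θ : Fin N → Param p) (D : Fin (n + 1) → X) (j : Fin (n + 1))
    (b : Fin N → Fin n → Bool) : Measure (Param p) :=
  ∑ J : Finset (Fin N),
    ENNReal.ofReal (M.rho t J) • M.incrementLaw t θ D (withRecord j b J)

/-- The noiseless increment, that is, the mean of the increment given the mini-batches `z`. -/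
def meanIncrement {n : ℕ} (θ : Fin N → Param p) (D : Fin n → X) (z : Fin N → Fin n → Bool) :
    Param p :=
  M.increment t θ D z 0

/-- The shift `v_J` of the mean of the increment between `D` and `D` without record `j`, given
that record `j` is included exactly by the runs in `J`. -/
def meanShift {n : ℕ} (θ : Fin N → Param p) (D : Fin (n + 1) → X) (j : Fin (n + 1))
    (b : Fin N → Fin n → Bool) (J : Finset (Fin N)) : Param p :=
  M.meanIncrement t θ D (withRecord j b J) - M.meanIncrement t θ (j.removeNth D) b

/-- The privacy loss `log (∑_J ρ_J φ(Y; v_J, s² I) / φ(Y; 0, s² I))`, where `Y` is the increment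
`y` centred at the mean of its law on `D` without record `j`. -/
def privacyLoss {n : ℕ} (θ : Fin N → Param p) (D : Fin (n + 1) → X) (j : Fin (n + 1))
    (b : Fin N → Fin n → Bool) (y : Param p) : ℝ :=
  Real.log
    ((∑ J : Finset (Fin N), M.rho t J *
        isoGaussianPDF (y - M.meanIncrement t θ (j.removeNth D) b)
          (M.meanShift t θ D j b J) (M.noiseVar t)) /
      isoGaussianPDF (y - M.meanIncrement t θ (j.removeNth D) b) 0 (M.noiseVar t))

/-- The law `N(0, s_λ²)` of the one-dimensional variable `Z`. -/
def surrogateLaw : Measure ℝ := gaussianReal 0 (M.noiseVar t).toNNReal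

/-- The surrogate privacy loss `log (∑_J ρ_J φ(z; Δ_J, s²) / φ(z; 0, s²))`. -/
def surrogateLoss (z : ℝ) : ℝ :=
  Real.log
    ((∑ J : Finset (Fin N), M.rho t J *
        gaussianPDFReal (M.Delta t J) (M.noiseVar t).toNNReal z) /
      gaussianPDFReal 0 (M.noiseVar t).toNNReal z)

end LinMixDPSGD

end

/-! Fix the mini-batches `b` among the common records. Then `Q` is a Gaussian `N(m, s²I)`, and `P`
is the mixture, with weights `ρ_J`, of its translates by `v_J`, where clipping gives `‖v_J‖ ≤ Δ_J`.
Given an event `S`, take the half-line `(c, ∞)` whose `N(0, s²)`-probability is `Q(S)`. By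
Neyman–Pearson, the translate by `v_J` gives `S` at most the probability of a half-space orthogonal
to `v_J`, which is the `N(‖v_J‖, s²)`-probability of `(c, ∞)`, and enlarging the shift to `Δ_J` only
increases it. The half-spaces vary with `J` but `c` does not, so a single half-line dominates the
whole mixture (`exists_real_event_dominating`, `exists_surrogate_event_dominating`).

Such domination of events bounds both hockey-stick divergences (`hockeyStick_bounds_of_dominated`),
and these are expectations because the supremum is attained where the integrand is positive. Without
conditioning on `b`, both laws are mixtures over `b` with the same weights, and joint convexity
(`hockeyStick_mixture_le`) finishes. -/

noncomputable section

/-! ### Hockey-stick divergences, log-densities and mixtures -/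

section HockeyStick

variable {Ω : Type*} [MeasurableSpace Ω]

lemma integral_max_zero_eq_setIntegral {μ : Measure Ω} {g : Ω → ℝ} (hg : Measurable g) :
    ∫ x, max (g x) 0 ∂μ = ∫ x in {x | 0 < g x}, g x ∂μ := by
  rw [← integral_indicator (measurableSet_lt measurable_const hg)]
  refine integral_congr_ae (.of_forall fun x => ?_)
  by_cases h : 0 < g x
  · simp [Set.indicator, h, h.le]
  · simp [Set.indicator, h, le_of_not_gt h]

lemma setIntegral_le_integral_max_zero {μ : Measure Ω} {g : Ω → ℝ} (hi : Integrable g μ)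
    (S : Set Ω) : ∫ x in S, g x ∂μ ≤ ∫ x, max (g x) 0 ∂μ :=
  (integral_mono hi.integrableOn hi.pos_part.integrableOn fun _ => le_max_left _ _).trans
    (setIntegral_le_integral hi.pos_part (.of_forall fun _ => le_max_right _ _))

/-- Dropping the negative part of `g` can only increase a set integral, and `{0 < g}` attains the
resulting bound. -/
lemma iSup_setIntegral_eq_integral_max_zero {μ : Measure Ω} {g : Ω → ℝ} (hg : Measurable g)
    (hi : Integrable g μ) :
    ⨆ S : {S : Set Ω // MeasurableSet S}, ∫ x in S.1, g x ∂μ = ∫ x, max (g x) 0 ∂μ := by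
  have : Nonempty {S : Set Ω // MeasurableSet S} := ⟨⟨∅, .empty⟩⟩
  refine le_antisymm (ciSup_le fun S => setIntegral_le_integral_max_zero hi S.1) ?_
  rw [integral_max_zero_eq_setIntegral hg]
  exact le_ciSup (f := fun S : {S : Set Ω // MeasurableSet S} => ∫ x in S.1, g x ∂μ)
    ⟨_, by rintro _ ⟨S, rfl⟩; exact setIntegral_le_integral_max_zero hi S.1⟩
    ⟨_, measurableSet_lt measurable_const hg⟩

/-- A real supremum is meaningful only for a bounded family; `P.real S ≤ 1` supplies the bound. -/
lemma le_hockeyStick (ε : ℝ) (P Q : Measure Ω) [IsProbabilityMeasure P] {S : Set Ω}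
    (hS : MeasurableSet S) : P.real S - Real.exp ε * Q.real S ≤ hockeyStick ε P Q := by
  refine le_ciSup (f := fun S : {S : Set Ω // MeasurableSet S} =>
    P.real S.1 - Real.exp ε * Q.real S.1) ⟨1, ?_⟩ ⟨S, hS⟩
  rintro _ ⟨S, rfl⟩
  have h1 : P.real S.1 ≤ 1 := measureReal_le_one
  have h2 : 0 ≤ Real.exp ε * Q.real S.1 := by positivity
  simp only
  linarith

lemma hockeyStick_le {ε c : ℝ} {P Q : Measure Ω}
    (h : ∀ S, MeasurableSet S → P.real S - Real.exp ε * Q.real S ≤ c) : hockeyStick ε P Q ≤ c := by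
  have : Nonempty {S : Set Ω // MeasurableSet S} := ⟨⟨∅, .empty⟩⟩
  exact ciSup_le fun S => h S.1 S.2

/-- `ℓ` is a version of the log-likelihood ratio of `P` with respect to `Q`. -/
structure IsLogDensity (P Q : Measure Ω) (ℓ : Ω → ℝ) : Prop where
  measurable : Measurable ℓ
  eq_withDensity : P = Q.withDensity fun x => ENNReal.ofReal (Real.exp (ℓ x))

namespace IsLogDensity

variable {P Q : Measure Ω} {ℓ : Ω → ℝ}

lemma measurable_exp (h : IsLogDensity P Q ℓ) : Measurable fun x => Real.exp (ℓ x) :=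
  Real.measurable_exp.comp h.measurable

lemma integrable_exp [IsFiniteMeasure P] (h : IsLogDensity P Q ℓ) :
    Integrable (fun x => Real.exp (ℓ x)) Q := by
  refine ⟨h.measurable_exp.aestronglyMeasurable, ?_⟩
  rw [hasFiniteIntegral_iff_ofReal (.of_forall fun _ => (Real.exp_pos _).le),
    ← setLIntegral_univ, ← withDensity_apply _ .univ, ← h.eq_withDensity]
  exact measure_lt_top _ _

lemma measureReal_eq (h : IsLogDensity P Q ℓ) {S : Set Ω} (hS : MeasurableSet S) :
    P.real S = ∫ x in S, Real.exp (ℓ x) ∂Q := by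
  rw [integral_eq_lintegral_of_nonneg_ae (.of_forall fun _ => (Real.exp_pos _).le)
    h.measurable_exp.aestronglyMeasurable, ← withDensity_apply _ hS, ← h.eq_withDensity,
    Measure.real]

lemma llr_ae_eq [SigmaFinite Q] (h : IsLogDensity P Q ℓ) : llr P Q =ᵐ[Q] ℓ := by
  have := Measure.rnDeriv_withDensity Q h.measurable_exp.ennreal_ofReal
  rw [← h.eq_withDensity] at this
  filter_upwards [this] with x hx
  simp [llr, hx, (Real.exp_pos _).le]

lemma hockeyStick_eq [IsFiniteMeasure P] [IsFiniteMeasure Q] (h : IsLogDensity P Q ℓ) (ε : ℝ) :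
    hockeyStick ε P Q = expectedExcess Q ℓ ε := by
  rw [expectedExcess, ← iSup_setIntegral_eq_integral_max_zero
    (h.measurable_exp.sub_const _) (h.integrable_exp.sub (integrable_const _)), hockeyStick]
  congr 1 with S
  rw [integral_sub h.integrable_exp.integrableOn (integrable_const _).integrableOn,
    h.measureReal_eq S.2]
  simp [mul_comm]

lemma hockeyStick_swap_eq [IsFiniteMeasure P] [IsFiniteMeasure Q] (h : IsLogDensity P Q ℓ)
    (ε : ℝ) : hockeyStick ε Q P = expectedDeficit Q ℓ ε := by
  have hi := h.integrable_exp.const_mul (Real.exp ε)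
  simp only [expectedDeficit, Real.exp_add]
  rw [← iSup_setIntegral_eq_integral_max_zero
    (g := fun x => 1 - Real.exp ε * Real.exp (ℓ x))
    (measurable_const.sub (h.measurable_exp.const_mul _)) ((integrable_const 1).sub hi),
    hockeyStick]
  congr 1 with S
  rw [integral_sub (integrable_const _).integrableOn hi.integrableOn, integral_const_mul,
    h.measureReal_eq S.2]
  simp

end IsLogDensity

/-- `P ≪ Q` provides the density. `Q ≪ P` makes it positive `Q`-almost everywhere, without which the
convention `log 0 = 0` would spoil `exp (llr P Q)`. -/
lemma isLogDensity_llr {P Q : Measure Ω} [SigmaFinite P] [SigmaFinite Q] (hPQ : P ≪ Q)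
    (hQP : Q ≪ P) : IsLogDensity P Q (llr P Q) := by
  refine ⟨measurable_llr P Q, ?_⟩
  conv_lhs => rw [← Measure.withDensity_rnDeriv_eq P Q hPQ]
  refine withDensity_congr_ae ?_
  filter_upwards [exp_llr_of_ac' P Q hQP, Measure.rnDeriv_lt_top P Q] with x hx hx'
  rw [hx, ENNReal.ofReal_toReal hx'.ne]

lemma sum_smul_withDensity_ofReal {ι : Type*} [Fintype ι] {μ : Measure Ω} {r : ι → ℝ}
    {f : ι → Ω → ℝ} (hr : ∀ i, 0 ≤ r i) (hf : ∀ i, Measurable (f i)) (hf0 : ∀ i x, 0 ≤ f i x) :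
    ∑ i, ENNReal.ofReal (r i) • μ.withDensity (fun x => ENNReal.ofReal (f i x)) =
      μ.withDensity fun x => ENNReal.ofReal (∑ i, r i * f i x) := by
  ext S hS
  rw [Measure.finsetSum_apply, withDensity_apply _ hS]
  simp_rw [ENNReal.ofReal_sum_of_nonneg (s := Finset.univ) fun i _ => mul_nonneg (hr i) (hf0 i _)]
  rw [lintegral_finsetSum _ fun i _ => ((hf i).const_mul _).ennreal_ofReal]
  refine Finset.sum_congr rfl fun i _ => ?_
  simp_rw [ENNReal.ofReal_mul (hr i)]
  rw [lintegral_const_mul _ (hf i).ennreal_ofReal, Measure.smul_apply, withDensity_apply _ hS,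
    smul_eq_mul]

/-- Individual weights may vanish, as when a sampling ratio is 0 or 1, but not all of them. -/
lemma sum_mul_pos_of_sum_eq_one {ι : Type*} [Fintype ι] {r a : ι → ℝ} (hr : ∀ i, 0 ≤ r i)
    (hr1 : ∑ i, r i = 1) (ha : ∀ i, 0 < a i) : 0 < ∑ i, r i * a i := by
  refine Finset.sum_pos' (fun i _ => mul_nonneg (hr i) (ha i).le) ?_
  obtain ⟨i, -, hi⟩ := Finset.exists_ne_zero_of_sum_ne_zero (s := Finset.univ) (f := r)
    (by rw [hr1]; exact one_ne_zero)
  exact ⟨i, Finset.mem_univ i, mul_pos ((hr i).lt_of_ne' hi) (ha i)⟩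

lemma isLogDensity_mixture {ι : Type*} [Fintype ι] {μ : Measure Ω} {r : ι → ℝ}
    {f : ι → Ω → ℝ} {g : Ω → ℝ} (hr : ∀ i, 0 ≤ r i) (hr1 : ∑ i, r i = 1)
    (hf : ∀ i, Measurable (f i)) (hf0 : ∀ i x, 0 < f i x) (hg : Measurable g)
    (hg0 : ∀ x, 0 < g x) :
    IsLogDensity (∑ i, ENNReal.ofReal (r i) • μ.withDensity fun x => ENNReal.ofReal (f i x))
      (μ.withDensity fun x => ENNReal.ofReal (g x))
      fun x => Real.log ((∑ i, r i * f i x) / g x) := by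
  have hm : Measurable fun x => Real.log ((∑ i, r i * f i x) / g x) :=
    Real.measurable_log.comp ((Finset.measurable_sum _ fun i _ => (hf i).const_mul _).div hg)
  refine ⟨hm, ?_⟩
  rw [sum_smul_withDensity_ofReal hr hf fun i x => (hf0 i x).le,
    ← withDensity_mul _ hg.ennreal_ofReal (Real.measurable_exp.fun_comp hm).ennreal_ofReal]
  congr with x
  rw [Pi.mul_apply, ← ENNReal.ofReal_mul (hg0 x).le,
    Real.exp_log (div_pos (sum_mul_pos_of_sum_eq_one hr hr1 fun i => hf0 i x) (hg0 x)),
    mul_div_cancel₀ _ (hg0 x).ne']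

lemma absolutelyContinuous_mixture {ι κ : Type*} [Fintype ι] [Fintype κ] {μ : Measure Ω}
    {r : ι → ℝ} {f : ι → Ω → ℝ} {s : κ → ℝ} {g : κ → Ω → ℝ} (hr : ∀ i, 0 ≤ r i)
    (hf : ∀ i, Measurable (f i)) (hf0 : ∀ i x, 0 ≤ f i x) (hs : ∀ i, 0 ≤ s i)
    (hs1 : ∑ i, s i = 1) (hg : ∀ i, Measurable (g i)) (hg0 : ∀ i x, 0 < g i x) :
    (∑ i, ENNReal.ofReal (r i) • μ.withDensity fun x => ENNReal.ofReal (f i x)) ≪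
      ∑ i, ENNReal.ofReal (s i) • μ.withDensity fun x => ENNReal.ofReal (g i x) := by
  rw [sum_smul_withDensity_ofReal hr hf hf0,
    sum_smul_withDensity_ofReal hs hg fun i x => (hg0 i x).le]
  -- The comparison passes through `μ`, which is absolutely continuous with respect to the second
  -- mixture because that density is positive.
  refine (withDensity_absolutelyContinuous _ _).trans (withDensity_absolutelyContinuous' ?_ ?_)
  · exact (Finset.measurable_sum _ fun i _ => (hg i).const_mul _).ennreal_ofReal.aemeasurable
  · exact .of_forall fun x => by simpa using sum_mul_pos_of_sum_eq_one hs hs1 fun i => hg0 i x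

lemma measureReal_sum_smul {ι : Type*} [Fintype ι] {r : ι → ℝ} (hr : ∀ i, 0 ≤ r i)
    (μ : ι → Measure Ω) [∀ i, IsFiniteMeasure (μ i)] (S : Set Ω) :
    (∑ i, ENNReal.ofReal (r i) • μ i).real S = ∑ i, r i * (μ i).real S := by
  rw [Measure.real, Measure.finsetSum_apply, ENNReal.toReal_sum fun i _ => by
    simpa using ENNReal.mul_ne_top ENNReal.ofReal_ne_top (measure_ne_top _ _)]
  simp [hr, Measure.real]

lemma isProbabilityMeasure_mixture {ι : Type*} [Fintype ι] {r : ι → ℝ} (hr : ∀ i, 0 ≤ r i)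
    (hr1 : ∑ i, r i = 1) (μ : ι → Measure Ω) [∀ i, IsProbabilityMeasure (μ i)] :
    IsProbabilityMeasure (∑ i, ENNReal.ofReal (r i) • μ i) := by
  refine ⟨?_⟩
  simp only [Measure.finsetSum_apply, Measure.smul_apply, measure_univ, smul_eq_mul, mul_one]
  rw [← ENNReal.ofReal_sum_of_nonneg fun i _ => hr i, hr1, ENNReal.ofReal_one]

/-- Hockey-stick divergences decrease in both directions if every event can be replaced by one of
equal second and no smaller first probability. -/
lemma hockeyStick_bounds_of_dominated {Ω' : Type*} [MeasurableSpace Ω'] {P Q : Measure Ω}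
    {P' Q' : Measure Ω'} [IsProbabilityMeasure P] [IsProbabilityMeasure Q]
    [IsProbabilityMeasure P'] [IsProbabilityMeasure Q']
    (h : ∀ S, MeasurableSet S → ∃ S', MeasurableSet S' ∧ Q.real S = Q'.real S' ∧
      P.real S ≤ P'.real S') (ε : ℝ) :
    hockeyStick ε P Q ≤ hockeyStick ε P' Q' ∧ hockeyStick ε Q P ≤ hockeyStick ε Q' P' := by
  refine ⟨hockeyStick_le fun S hS => ?_, hockeyStick_le fun S hS => ?_⟩
  · obtain ⟨S', hS', hQ, hP⟩ := h S hS
    have := le_hockeyStick ε P' Q' hS'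
    rw [hQ]
    linarith
  -- Dominating the complement reverses the inequality: `S'ᶜ` has the `Q'`-probability of `S` and no
  -- larger `P'`-probability.
  · obtain ⟨S', hS', hQ, hP⟩ := h Sᶜ hS.compl
    have := le_hockeyStick ε Q' P' hS'.compl
    rw [probReal_compl_eq_one_sub hS'] at this
    rw [probReal_compl_eq_one_sub hS] at hQ hP
    rw [probReal_compl_eq_one_sub hS'] at this
    have := mul_le_mul_of_nonneg_left hP (Real.exp_pos ε).le
    linarith

/-- Joint convexity: for each event the difference for the mixtures is the average of the
componentwise differences. -/
lemma hockeyStick_mixture_le {ι : Type*} [Fintype ι] {r : ι → ℝ} (hr : ∀ i, 0 ≤ r i)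
    (hr1 : ∑ i, r i = 1) (P Q : ι → Measure Ω) [∀ i, IsProbabilityMeasure (P i)]
    [∀ i, IsProbabilityMeasure (Q i)] {ε c : ℝ} (h : ∀ i, hockeyStick ε (P i) (Q i) ≤ c) :
    hockeyStick ε (∑ i, ENNReal.ofReal (r i) • P i) (∑ i, ENNReal.ofReal (r i) • Q i) ≤ c := by
  refine hockeyStick_le fun S hS => ?_
  rw [measureReal_sum_smul hr, measureReal_sum_smul hr, Finset.mul_sum, ← Finset.sum_sub_distrib]
  calc ∑ i, (r i * (P i).real S - Real.exp ε * (r i * (Q i).real S))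
      ≤ ∑ i, r i * c := Finset.sum_le_sum fun i _ => by
        have := mul_le_mul_of_nonneg_left ((le_hockeyStick ε (P i) (Q i) hS).trans (h i)) (hr i)
        linarith
    _ = c := by rw [← Finset.sum_mul, hr1, one_mul]

end HockeyStick
end

/-! ### Isotropic Gaussians and the Neyman–Pearson comparison -/

noncomputable section
section Gaussian

variable {p : ℕ}

lemma isoGaussianPDF_pos (y m : Param p) {v : ℝ} (hv : 0 < v) : 0 < isoGaussianPDF y m v := by
  unfold isoGaussianPDF
  positivity

lemma measurable_isoGaussianPDF (m : Param p) (v : ℝ) :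
    Measurable fun y => isoGaussianPDF y m v := by
  unfold isoGaussianPDF
  fun_prop

/-- The Gaussian measure `N(m, v I)` given by its density. -/
def gaussianDensityMeasure (m : Param p) (v : ℝ) : Measure (Param p) :=
  volume.withDensity fun y => ENNReal.ofReal (isoGaussianPDF y m v)

lemma integral_gaussianDensityMeasure {m : Param p} {v : ℝ} (hv : 0 < v) (f : Param p → ℂ) :
    ∫ y, f y ∂gaussianDensityMeasure m v = ∫ y, isoGaussianPDF y m v • f y := by
  rw [gaussianDensityMeasure, integral_withDensity_eq_integral_toReal_smul
    (measurable_isoGaussianPDF m v).ennreal_ofReal (.of_forall fun _ => ENNReal.ofReal_lt_top)]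
  simp [(isoGaussianPDF_pos _ m hv).le]

open scoped RealInnerProductSpace in
lemma charFun_gaussianDensityMeasure (m : Param p) {v : ℝ} (hv : 0 < v) (t : Param p) :
    charFun (gaussianDensityMeasure m v) t =
      Complex.exp (⟪m, t⟫ * Complex.I - v * ‖t‖ ^ 2 / 2) := by
  have hb : 0 < ((1 / (2 * v) : ℝ) : ℂ).re := by
    rw [Complex.ofReal_re]; positivity
  -- After translation by `m`, the characteristic function is this Fourier integral with `b =
  -- 1/(2v)`.
  have key := GaussianFourier.integral_cexp_neg_mul_sq_norm_add (V := Param p) hb Complex.I t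
  rw [charFun_apply, integral_gaussianDensityMeasure hv,
    ← integral_add_right_eq_self (μ := volume) _ m]
  have hint : ∀ y : Param p, isoGaussianPDF (y + m) m v • Complex.exp (⟪y + m, t⟫ * Complex.I) =
      (((Real.sqrt (2 * Real.pi * v))⁻¹ ^ p : ℝ) * Complex.exp (⟪m, t⟫ * Complex.I)) *
        Complex.exp (-((1 / (2 * v) : ℝ) : ℂ) * ‖y‖ ^ 2 + Complex.I * ⟪t, y⟫) := by
    intro y
    rw [isoGaussianPDF, add_sub_cancel_right, inner_add_left, real_inner_comm y t,
      Complex.real_smul, Complex.ofReal_mul]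
    generalize (((Real.sqrt (2 * Real.pi * v))⁻¹ ^ p : ℝ) : ℂ) = A
    push_cast
    rw [mul_assoc, mul_assoc, ← Complex.exp_add, ← Complex.exp_add]
    congr 2
    field_simp
    ring
  simp_rw [hint]
  rw [integral_const_mul, key]
  -- The normalisation `(2πv)^(-p/2)` cancels the factor `(π/b)^(p/2)`.
  have hconst : (((Real.sqrt (2 * Real.pi * v))⁻¹ ^ p : ℝ) : ℂ) *
      (Real.pi / ((1 / (2 * v) : ℝ) : ℂ)) ^ (Module.finrank ℝ (Param p) / 2 : ℂ) = 1 := by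
    have h2 : (0 : ℝ) < 2 * Real.pi * v := by positivity
    have : (Real.pi / ((1 / (2 * v) : ℝ) : ℂ)) = ((2 * Real.pi * v : ℝ) : ℂ) := by
      push_cast; field_simp
    rw [this, finrank_euclideanSpace_fin,
      show ((p : ℂ) / 2) = (((p : ℝ) / 2 : ℝ) : ℂ) by push_cast; rfl,
      ← Complex.ofReal_cpow h2.le, ← Complex.ofReal_mul, Real.sqrt_eq_rpow,
      ← Real.rpow_neg h2.le, ← Real.rpow_natCast, ← Real.rpow_mul h2.le, ← Real.rpow_add h2]
    ring_nf
    simp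
  rw [mul_right_comm, mul_assoc, ← mul_assoc, ← mul_assoc, hconst, one_mul, ← Complex.exp_add]
  congr 1
  push_cast
  rw [Complex.I_sq]
  field_simp
  ring

lemma isProbabilityMeasure_gaussianDensityMeasure (m : Param p) {v : ℝ} (hv : 0 < v) :
    IsProbabilityMeasure (gaussianDensityMeasure m v) := by
  -- The total mass is the characteristic function at 0.
  have h := charFun_gaussianDensityMeasure m hv 0
  simp only [charFun_zero, inner_zero_right, norm_zero] at h
  refine ⟨(ENNReal.toReal_eq_one_iff _).1 ?_⟩
  exact_mod_cast (by simpa using h : ((gaussianDensityMeasure m v).real Set.univ : ℂ) = 1)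

open scoped RealInnerProductSpace in
lemma eq_gaussianDensityMeasure {μ : Measure (Param p)} [IsFiniteMeasure μ] {m : Param p} {v : ℝ}
    (hv : 0 < v) (h : ∀ t, charFun μ t = Complex.exp (⟪m, t⟫ * Complex.I - v * ‖t‖ ^ 2 / 2)) :
    μ = gaussianDensityMeasure m v := by
  have := isProbabilityMeasure_gaussianDensityMeasure m hv
  refine Measure.ext_of_charFun ?_
  ext t
  rw [h, charFun_gaussianDensityMeasure m hv]

open scoped RealInnerProductSpace in
-- Turns probabilities of half-spaces into probabilities of half-lines.
lemma map_inner_gaussianDensityMeasure (m a u : Param p) {v : ℝ} (hv : 0 < v) (hu : ‖u‖ = 1) :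
    (gaussianDensityMeasure m v).map (fun y => ⟪y - a, u⟫) =
      gaussianReal ⟪m - a, u⟫ v.toNNReal := by
  have := isProbabilityMeasure_gaussianDensityMeasure m hv
  have hm : Measurable fun y : Param p => ⟪y - a, u⟫ := by fun_prop
  have := Measure.isProbabilityMeasure_map (μ := gaussianDensityMeasure m v) hm.aemeasurable
  refine Measure.ext_of_charFun ?_
  ext t
  rw [charFun_apply_real, integral_map hm.aemeasurable (by fun_prop), charFun_gaussianReal]
  have hpt : ∀ y : Param p, Complex.exp (t * (⟪y - a, u⟫ : ℝ) * Complex.I) =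
      Complex.exp (-(t * ⟪a, u⟫ * Complex.I)) * Complex.exp (⟪y, t • u⟫ * Complex.I) := by
    intro y
    rw [← Complex.exp_add, inner_sub_left, real_inner_smul_right]
    push_cast
    ring_nf
  simp_rw [hpt]
  rw [integral_const_mul, ← charFun_apply, charFun_gaussianDensityMeasure m hv,
    ← Complex.exp_add, norm_smul, hu, inner_sub_left, real_inner_smul_right]
  congr 1
  simp [hv.le, ← Complex.ofReal_pow]
  ring

lemma integrable_isoGaussianPDF (m : Param p) {v : ℝ} (hv : 0 < v) :
    Integrable (fun y => isoGaussianPDF y m v) := by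
  have := isProbabilityMeasure_gaussianDensityMeasure m hv
  refine ⟨(measurable_isoGaussianPDF m v).aestronglyMeasurable, ?_⟩
  rw [hasFiniteIntegral_iff_ofReal (.of_forall fun _ => (isoGaussianPDF_pos _ m hv).le),
    ← setLIntegral_univ, ← withDensity_apply _ .univ]
  exact measure_lt_top (gaussianDensityMeasure m v) _

lemma gaussianDensityMeasure_real_apply (m : Param p) {v : ℝ} (hv : 0 < v) {S : Set (Param p)}
    (hS : MeasurableSet S) :
    (gaussianDensityMeasure m v).real S = ∫ y in S, isoGaussianPDF y m v := by
  rw [integral_eq_lintegral_of_nonneg_ae (.of_forall fun _ => (isoGaussianPDF_pos _ m hv).le)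
    (measurable_isoGaussianPDF m v).aestronglyMeasurable, ← withDensity_apply _ hS]
  rfl

open scoped RealInnerProductSpace in
-- The likelihood ratio increases with `⟪y - m, x⟫` when `v > 0`, so its superlevel sets are
-- half-spaces.
lemma isoGaussianPDF_add (y m x : Param p) (v : ℝ) :
    isoGaussianPDF y (m + x) v =
      Real.exp ((⟪y - m, x⟫ - ‖x‖ ^ 2 / 2) / v) * isoGaussianPDF y m v := by
  rw [isoGaussianPDF, isoGaussianPDF, mul_left_comm, ← Real.exp_add, ← sub_sub, norm_sub_sq_real]
  rcases eq_or_ne v 0 with rfl | hv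
  · simp
  congr 2
  field_simp
  ring

open scoped RealInnerProductSpace in
/-- Neyman--Pearson lemma for the shift of an isotropic Gaussian by `x`. -/
lemma gaussianDensityMeasure_add_le (m x : Param p) {v : ℝ} (hv : 0 < v) (c : ℝ)
    {S : Set (Param p)} (hS : MeasurableSet S)
    (h : (gaussianDensityMeasure m v).real S =
      (gaussianDensityMeasure m v).real {y | c < ⟪y - m, x⟫}) :
    (gaussianDensityMeasure (m + x) v).real S ≤
      (gaussianDensityMeasure (m + x) v).real {y | c < ⟪y - m, x⟫} := by
  -- The value of the likelihood ratio on the bounding hyperplane `⟪y - m, x⟫ = c`.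
  set k := Real.exp ((c - ‖x‖ ^ 2 / 2) / v) with hk
  have hH : MeasurableSet {y : Param p | c < ⟪y - m, x⟫} :=
    measurableSet_lt measurable_const (by fun_prop)
  have hset : {y : Param p | c < ⟪y - m, x⟫} =
      {y | 0 < isoGaussianPDF y (m + x) v - k * isoGaussianPDF y m v} := by
    ext y
    rw [Set.mem_ofPred_eq, Set.mem_ofPred_eq, isoGaussianPDF_add, ← sub_mul,
      mul_pos_iff_of_pos_right (isoGaussianPDF_pos y m hv), sub_pos, hk, Real.exp_lt_exp,
      div_lt_div_iff_of_pos_right hv, sub_lt_sub_iff_right]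
  have i1 := integrable_isoGaussianPDF (m + x) hv
  have i0 := (integrable_isoGaussianPDF m hv).const_mul k
  -- The half-space maximises the integral of the difference of densities; the terms with `k` then
  -- cancel by `h`.
  have key := setIntegral_le_integral_max_zero (i1.sub i0) S
  rw [integral_max_zero_eq_setIntegral ((measurable_isoGaussianPDF (m + x) v).sub
    ((measurable_isoGaussianPDF m v).const_mul k))] at key
  simp only [Pi.sub_apply] at key
  rw [← hset, integral_sub i1.integrableOn i0.integrableOn,
    integral_sub i1.integrableOn i0.integrableOn, integral_const_mul, integral_const_mul,
    ← gaussianDensityMeasure_real_apply _ hv hS, ← gaussianDensityMeasure_real_apply _ hv hS,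
    ← gaussianDensityMeasure_real_apply _ hv hH, ← gaussianDensityMeasure_real_apply _ hv hH,
    h] at key
  linarith

lemma continuous_gaussianReal_real_Iic (m : ℝ) {v : NNReal} (hv : v ≠ 0) :
    Continuous fun c => (gaussianReal m v).real (Set.Iic c) := by
  have h : (fun c => (gaussianReal m v).real (Set.Iic c)) =
      fun c => ∫ x in Set.Iic c, gaussianPDFReal m v x := by
    ext c
    rw [Measure.real, gaussianReal_apply_eq_integral _ hv, ENNReal.toReal_ofReal]
    exact integral_nonneg fun x => gaussianPDFReal_nonneg _ _ _
  rw [h]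
  have h2 : (fun c => ∫ x in Set.Iic c, gaussianPDFReal m v x) =
      fun c => (∫ x in (0 : ℝ)..c, gaussianPDFReal m v x) +
        ∫ x in Set.Iic 0, gaussianPDFReal m v x := by
    ext c
    rw [← intervalIntegral.integral_Iic_sub_Iic (integrable_gaussianPDFReal m v).integrableOn
      (integrable_gaussianPDFReal m v).integrableOn, sub_add_cancel]
  rw [h2]
  exact (intervalIntegral.continuous_primitive
    (fun a b => (integrable_gaussianPDFReal m v).intervalIntegrable) 0).add continuous_const

/-- Intermediate value theorem for the distribution function; `0 < a < 1` puts `1 - a` strictly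
between its limits. -/
lemma exists_gaussianReal_real_Ioi_eq (m : ℝ) {v : NNReal} (hv : v ≠ 0) {a : ℝ} (h0 : 0 < a)
    (h1 : a < 1) : ∃ c, (gaussianReal m v).real (Set.Ioi c) = a := by
  obtain ⟨c, hc⟩ : ∃ c, (gaussianReal m v).real (Set.Iic c) = 1 - a := by
    have hbot := tendsto_cdf_atBot (gaussianReal m v)
    have htop := tendsto_cdf_atTop (gaussianReal m v)
    simp_rw [funext (cdf_eq_real (gaussianReal m v))] at hbot htop
    exact mem_range_of_exists_le_of_exists_ge (continuous_gaussianReal_real_Iic m hv)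
      ((hbot.eventually_le_const (by linarith : 0 < 1 - a)).exists)
      ((htop.eventually_const_le (by linarith : 1 - a < 1)).exists)
  refine ⟨c, ?_⟩
  rw [← Set.compl_Iic, probReal_compl_eq_one_sub measurableSet_Iic, hc]
  ring

lemma gaussianReal_real_Ioi_mono {m m' : ℝ} (h : m ≤ m') (v : NNReal) (c : ℝ) :
    (gaussianReal m v).real (Set.Ioi c) ≤ (gaussianReal m' v).real (Set.Ioi c) := by
  have hm : gaussianReal m' v = (gaussianReal m v).map (· + (m' - m)) := by
    rw [gaussianReal_map_add_const]
    congr 1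
    ring
  rw [hm, map_measureReal_apply (by fun_prop) measurableSet_Ioi]
  refine measureReal_mono fun x hx => ?_
  simp only [Set.mem_preimage, Set.mem_Ioi] at hx ⊢
  linarith

open scoped RealInnerProductSpace in
/-- For every event `S` there is an event `S'` of the real line that has under `N(0, v)` the same
probability as `S` under `N(m, v I)`, and under `N(d, v)` at least the probability of `S` under
`N(m + x, v I)` whenever `‖x‖ ≤ d`. -/
lemma exists_real_event_dominating (m : Param p) {v : ℝ} (hv : 0 < v) {S : Set (Param p)}
    (hS : MeasurableSet S) :
    ∃ S' : Set ℝ, MeasurableSet S' ∧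
      (gaussianDensityMeasure m v).real S = (gaussianReal 0 v.toNNReal).real S' ∧
      ∀ (x : Param p) (d : ℝ), ‖x‖ ≤ d →
        (gaussianDensityMeasure (m + x) v).real S ≤ (gaussianReal d v.toNNReal).real S' := by
  have hprob := fun m : Param p => isProbabilityMeasure_gaussianDensityMeasure m hv
  have hv' : v.toNNReal ≠ 0 := by simpa using hv
  -- Probabilities 0 and 1 correspond to no finite threshold and are treated apart.
  rcases (measureReal_nonneg (μ := gaussianDensityMeasure m v) (s := S)).eq_or_lt with h0 | h0
  · refine ⟨∅, .empty, by simp [← h0], fun x d _ => ?_⟩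
    have hac : gaussianDensityMeasure (m + x) v ≪ gaussianDensityMeasure m v :=
      (withDensity_absolutelyContinuous _ _).trans (withDensity_absolutelyContinuous'
        (measurable_isoGaussianPDF m v).ennreal_ofReal.aemeasurable
        (.of_forall fun y => by simpa using isoGaussianPDF_pos y m hv))
    simp [Measure.real, hac ((measureReal_eq_zero_iff).1 h0.symm)]
  rcases (measureReal_le_one (μ := gaussianDensityMeasure m v) (s := S)).eq_or_lt with h1 | h1
  · exact ⟨Set.univ, .univ, by simp [h1], fun x d _ => by simp⟩
  -- The threshold is chosen before `x` and `d`, so one event serves all shifts.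
  obtain ⟨c, hc⟩ := exists_gaussianReal_real_Ioi_eq 0 hv' h0 h1
  refine ⟨Set.Ioi c, measurableSet_Ioi, hc.symm, fun x d hx => ?_⟩
  refine le_trans ?_ (gaussianReal_real_Ioi_mono hx _ _)
  rcases eq_or_ne x 0 with rfl | hx0
  · simp [hc]
  have hxn : 0 < ‖x‖ := norm_pos_iff.2 hx0
  set u := ‖x‖⁻¹ • x with hu
  have hu1 : ‖u‖ = 1 := by rw [hu, norm_smul, norm_inv, norm_norm, inv_mul_cancel₀ hxn.ne']
  have hset : {y : Param p | c * ‖x‖ < ⟪y - m, x⟫} = (fun y => ⟪y - m, u⟫) ⁻¹' Set.Ioi c := by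
    ext y
    rw [Set.mem_preimage, Set.mem_Ioi, hu, real_inner_smul_right, ← div_eq_inv_mul,
      lt_div_iff₀ hxn, Set.mem_ofPred_eq]
  have hlaw : ∀ m', (gaussianDensityMeasure m' v).real {y | c * ‖x‖ < ⟪y - m, x⟫} =
      (gaussianReal ⟪m' - m, u⟫ v.toNNReal).real (Set.Ioi c) := by
    intro m'
    rw [hset, ← map_inner_gaussianDensityMeasure m' m u hv hu1,
      map_measureReal_apply (by fun_prop) measurableSet_Ioi]
  have hxu : ⟪m + x - m, u⟫ = ‖x‖ := by
    rw [add_sub_cancel_left, hu, real_inner_smul_right, real_inner_self_eq_norm_sq]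
    field_simp
  have := gaussianDensityMeasure_add_le m x hv (c * ‖x‖) hS (by rw [hlaw, sub_self,
    inner_zero_left, hc])
  rwa [hlaw, hxu] at this

end Gaussian
end

/-! ### The DP-SGD step and its surrogate -/

noncomputable section

lemma norm_clip_le {p : ℕ} (g : Param p) {c : ℝ} (hc : 0 ≤ c) : ‖clip g c‖ ≤ c := by
  rcases eq_or_ne g 0 with rfl | hg
  · simpa [clip] using hc
  have hg' : 0 < ‖g‖ := norm_pos_iff.2 hg
  rw [clip, norm_smul, Real.norm_of_nonneg (le_min zero_le_one (by positivity))]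
  calc min 1 (c / ‖g‖) * ‖g‖ ≤ c / ‖g‖ * ‖g‖ := by gcongr; exact min_le_right _ _
    _ = c := div_mul_cancel₀ _ hg'.ne'

instance isProbabilityMeasure_isoGaussian (p : ℕ) (c : ℝ) :
    IsProbabilityMeasure (isoGaussian p c) :=
  Measure.isProbabilityMeasure_map (by fun_prop)

lemma charFun_isoGaussian {p : ℕ} (c : ℝ) (t : Param p) :
    charFun (isoGaussian p c) t = Complex.exp (-((c ^ 2 * ‖t‖ ^ 2 / 2 : ℝ) : ℂ)) := by
  rw [isoGaussian, charFun_map_smul, charFun_stdGaussian, norm_smul]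
  congr 1
  push_cast
  rw [mul_pow, ← Complex.ofReal_pow ‖c‖, Real.norm_eq_abs, sq_abs]
  push_cast
  ring

open scoped RealInnerProductSpace in
lemma charFun_map_const_add_sum_smul {ι E : Type*} [Fintype ι] [NormedAddCommGroup E]
    [InnerProductSpace ℝ E] [MeasurableSpace E] [BorelSpace E] [SecondCountableTopology E]
    (μ : ι → Measure E) [∀ i, IsProbabilityMeasure (μ i)] (a : ι → ℝ) (m t : E) :
    charFun ((Measure.pi μ).map fun e => m + ∑ i, a i • e i) t =
      Complex.exp (⟪m, t⟫ * Complex.I) * ∏ i, charFun (μ i) (a i • t) := by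
  rw [charFun_apply, integral_map (Measurable.aemeasurable (by fun_prop))
    (Measurable.aestronglyMeasurable (by fun_prop))]
  simp_rw [inner_add_left, sum_inner, real_inner_smul_left, Complex.ofReal_add, add_mul,
    Complex.exp_add, Complex.ofReal_sum, Finset.sum_mul, Complex.exp_sum]
  rw [integral_const_mul, integral_fintype_prod_eq_prod
    (f := fun i (x : E) => Complex.exp (((a i * ⟪x, t⟫ : ℝ) : ℂ) * Complex.I))]
  simp_rw [charFun_apply, real_inner_smul_right]

namespace LinMixDPSGD

variable {N p T : ℕ} {X : Type*} (M : LinMixDPSGD N p T X) (t : Fin T)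

lemma rho_nonneg (J : Finset (Fin N)) : 0 ≤ M.rho t J :=
  mul_nonneg (Finset.prod_nonneg fun i _ => (M.q_mem t i).1)
    (Finset.prod_nonneg fun i _ => sub_nonneg.2 (M.q_mem t i).2)

/-- Expand `∏ i, (q i + (1 - q i)) = 1` over subsets. -/
lemma sum_rho : ∑ J, M.rho t J = 1 := by
  have := Finset.prod_add (M.q t) (fun i => 1 - M.q t i) Finset.univ
  simp only [add_sub_cancel, Finset.prod_const_one, Finset.powerset_univ] at this
  simpa only [rho, Finset.compl_eq_univ_sdiff] using this.symm

lemma rho_eq_prod_ite (J : Finset (Fin N)) :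
    M.rho t J = ∏ i, if i ∈ J then M.q t i else 1 - M.q t i := by
  rw [Finset.prod_ite, rho]
  congr 2 <;> ext <;> simp

lemma selectionProb_nonneg {n : ℕ} (z : Fin N → Fin n → Bool) : 0 ≤ M.selectionProb t z :=
  Finset.prod_nonneg fun i _ => Finset.prod_nonneg fun k _ => by
    have := M.q_mem t i
    split_ifs
    exacts [this.1, sub_nonneg.2 this.2]

lemma sum_selectionProb (n : ℕ) : ∑ z : Fin N → Fin n → Bool, M.selectionProb t z = 1 := by
  simp_rw [selectionProb]
  rw [← Fintype.prod_sum
    (f := fun i (z : Fin n → Bool) => ∏ k, if z k then M.q t i else 1 - M.q t i)]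
  refine Finset.prod_eq_one fun i _ => ?_
  rw [← Fintype.prod_sum (f := fun _ (c : Bool) => if c then M.q t i else 1 - M.q t i)]
  simp

/-- The selections of `n + 1` records are the selections of the records other than `j` together
with the sets of runs that include record `j`. -/
def withRecordEquiv {n : ℕ} (j : Fin (n + 1)) :
    (Fin N → Fin n → Bool) × Finset (Fin N) ≃ (Fin N → Fin (n + 1) → Bool) where
  toFun x := withRecord j x.1 x.2
  invFun z := (fun i => j.removeNth (z i), Finset.univ.filter fun i => z i j)
  left_inv x := by ext <;> simp [withRecord]
  right_inv z := by ext i k; simp [withRecord]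

lemma selectionProb_withRecord {n : ℕ} (j : Fin (n + 1)) (b : Fin N → Fin n → Bool)
    (J : Finset (Fin N)) :
    M.selectionProb t (withRecord j b J) = M.selectionProb t b * M.rho t J := by
  simp_rw [rho_eq_prod_ite, selectionProb, Fin.prod_univ_succAbove _ j, withRecord]
  rw [← Finset.prod_mul_distrib]
  refine Finset.prod_congr rfl fun i _ => ?_
  simp [mul_comm]

/-- Record `j` is sampled independently of the others, so the weights are exactly those of `stepLaw`
on `j.removeNth D`. -/
lemma stepLaw_eq_sum_stepLawGiven {n : ℕ} (θ : Fin N → Param p) (D : Fin (n + 1) → X)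
    (j : Fin (n + 1)) :
    M.stepLaw t θ D =
      ∑ b, ENNReal.ofReal (M.selectionProb t b) • M.stepLawGiven t θ D j b := by
  rw [stepLaw, ← (withRecordEquiv j).sum_comp, Fintype.sum_prod_type]
  refine Finset.sum_congr rfl fun b _ => ?_
  rw [stepLawGiven, Finset.smul_sum]
  refine Finset.sum_congr rfl fun J _ => ?_
  rw [smul_smul, ← ENNReal.ofReal_mul (M.selectionProb_nonneg t b), ← selectionProb_withRecord]
  rfl

lemma meanIncrement_eq {n : ℕ} (θ : Fin N → Param p) (D : Fin n → X)
    (z : Fin N → Fin n → Bool) :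
    M.meanIncrement t θ D z = -∑ i, (M.lam i * M.eta t i) • M.clippedGrad t θ D z i := by
  simp [meanIncrement, increment, nextIterate, smul_sub, smul_smul]

lemma increment_eq {n : ℕ} (θ : Fin N → Param p) (D : Fin n → X) (z : Fin N → Fin n → Bool)
    (e : Fin N → Param p) :
    M.increment t θ D z e =
      M.meanIncrement t θ D z + ∑ i, (-(M.lam i * M.eta t i)) • e i := by
  rw [meanIncrement_eq]
  simp only [increment, nextIterate, smul_sub, smul_add, smul_smul, Finset.sum_sub_distrib,
    Finset.sum_add_distrib, neg_smul, Finset.sum_neg_distrib]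
  abel

/-- The characteristic functions of the independent noises multiply, so the variances `(λ_i η_i σ_i
C_i)²` add up to `noiseVar`. -/
lemma incrementLaw_eq (hs : 0 < M.noiseVar t) {n : ℕ} (θ : Fin N → Param p) (D : Fin n → X)
    (z : Fin N → Fin n → Bool) :
    M.incrementLaw t θ D z =
      gaussianDensityMeasure (M.meanIncrement t θ D z) (M.noiseVar t) := by
  rw [incrementLaw, funext (M.increment_eq t θ D z), noiseLaw]
  have := Measure.isProbabilityMeasure_map
    (μ := Measure.pi fun i => isoGaussian p (M.sigma t i * M.C t i))
    (f := fun e => M.meanIncrement t θ D z + ∑ i, (-(M.lam i * M.eta t i)) • e i) (Measurable.aemeasurable (by fun_prop))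
  refine eq_gaussianDensityMeasure hs fun u => ?_
  rw [charFun_map_const_add_sum_smul]
  simp_rw [charFun_isoGaussian]
  rw [← Complex.exp_sum, ← Complex.exp_add, Finset.sum_neg_distrib, ← sub_eq_add_neg,
    ← Complex.ofReal_sum]
  congr 2
  rw [noiseVar]
  norm_cast
  rw [Finset.sum_mul, Finset.sum_div]
  refine Finset.sum_congr rfl fun i _ => ?_
  rw [norm_smul, mul_pow _ ‖u‖, Real.norm_eq_abs, sq_abs]
  ring

instance isProbabilityMeasure_incrementLaw {n : ℕ} (θ : Fin N → Param p) (D : Fin n → X)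
    (z : Fin N → Fin n → Bool) : IsProbabilityMeasure (M.incrementLaw t θ D z) := by
  rw [incrementLaw, funext (M.increment_eq t θ D z), noiseLaw]
  exact Measure.isProbabilityMeasure_map (Measurable.aemeasurable (by fun_prop))

instance isProbabilityMeasure_stepLawGiven {n : ℕ} (θ : Fin N → Param p) (D : Fin (n + 1) → X)
    (j : Fin (n + 1)) (b : Fin N → Fin n → Bool) :
    IsProbabilityMeasure (M.stepLawGiven t θ D j b) :=
  isProbabilityMeasure_mixture (M.rho_nonneg t) (M.sum_rho t) _

instance isProbabilityMeasure_stepLaw {n : ℕ} (θ : Fin N → Param p) (D : Fin n → X) :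
    IsProbabilityMeasure (M.stepLaw t θ D) :=
  isProbabilityMeasure_mixture (M.selectionProb_nonneg t) (M.sum_selectionProb t n) _

lemma clippedGrad_withRecord {n : ℕ} (θ : Fin N → Param p) (D : Fin (n + 1) → X)
    (j : Fin (n + 1)) (b : Fin N → Fin n → Bool) (J : Finset (Fin N)) (i : Fin N) :
    M.clippedGrad t θ D (withRecord j b J) i =
      (if i ∈ J then clip (M.grad t i (θ i) (D j)) (M.C t i) else 0) +
        M.clippedGrad t θ (j.removeNth D) b i := by
  simp [clippedGrad, Fin.sum_univ_succAbove _ j, withRecord, Fin.removeNth]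

lemma norm_meanShift_le {n : ℕ} (θ : Fin N → Param p) (D : Fin (n + 1) → X)
    (j : Fin (n + 1)) (b : Fin N → Fin n → Bool) (J : Finset (Fin N)) :
    ‖M.meanShift t θ D j b J‖ ≤ M.Delta t J := by
  -- The contributions of the common records cancel, leaving only the clipped gradients of record
  -- `j`.
  have h : M.meanShift t θ D j b J =
      -∑ i ∈ J, (M.lam i * M.eta t i) • clip (M.grad t i (θ i) (D j)) (M.C t i) := by
    rw [meanShift, meanIncrement_eq, meanIncrement_eq]
    simp only [clippedGrad_withRecord, smul_add, Finset.sum_add_distrib, smul_ite, smul_zero,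
      Finset.sum_ite_mem, Finset.univ_inter]
    abel
  rw [h, norm_neg, Delta]
  refine (norm_sum_le _ _).trans (Finset.sum_le_sum fun i _ => ?_)
  have hi : 0 ≤ M.lam i * M.eta t i := mul_nonneg (M.lam_mem.1 i) (M.eta_nonneg t i)
  rw [norm_smul, Real.norm_of_nonneg hi, w]
  exact mul_le_mul_of_nonneg_left (norm_clip_le _ (M.C_nonneg t i)) hi

/-- The law with privacy loss `surrogateLoss` relative to `surrogateLaw`. -/
def surrogateMixture : Measure ℝ :=
  ∑ J : Finset (Fin N),
    ENNReal.ofReal (M.rho t J) • gaussianReal (M.Delta t J) (M.noiseVar t).toNNReal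

instance isProbabilityMeasure_surrogateMixture :
    IsProbabilityMeasure (M.surrogateMixture t) :=
  isProbabilityMeasure_mixture (M.rho_nonneg t) (M.sum_rho t) _

instance isProbabilityMeasure_surrogateLaw : IsProbabilityMeasure (M.surrogateLaw t) := by
  unfold surrogateLaw
  infer_instance

lemma isLogDensity_surrogateLoss (hs : 0 < M.noiseVar t) :
    IsLogDensity (M.surrogateMixture t) (M.surrogateLaw t) (M.surrogateLoss t) := by
  have hv : (M.noiseVar t).toNNReal ≠ 0 := by simpa using hs
  have := isLogDensity_mixture (μ := volume) (M.rho_nonneg t) (M.sum_rho t)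
    (fun J => measurable_gaussianPDFReal (M.Delta t J) (M.noiseVar t).toNNReal)
    (fun J z => gaussianPDFReal_pos _ _ z hv)
    (measurable_gaussianPDFReal 0 (M.noiseVar t).toNNReal)
    (fun z => gaussianPDFReal_pos _ _ z hv)
  simp only [surrogateMixture, surrogateLaw, gaussianReal_of_var_ne_zero _ hv]
  exact this

lemma isLogDensity_privacyLoss (hs : 0 < M.noiseVar t) {n : ℕ} (θ : Fin N → Param p)
    (D : Fin (n + 1) → X) (j : Fin (n + 1)) (b : Fin N → Fin n → Bool) :
    IsLogDensity (M.stepLawGiven t θ D j b) (M.incrementLaw t θ (j.removeNth D) b)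
      (M.privacyLoss t θ D j b) := by
  have := isLogDensity_mixture (μ := volume) (M.rho_nonneg t) (M.sum_rho t)
    (fun J => measurable_isoGaussianPDF (M.meanIncrement t θ D (withRecord j b J)) (M.noiseVar t))
    (fun J y => isoGaussianPDF_pos y _ hs)
    (measurable_isoGaussianPDF (M.meanIncrement t θ (j.removeNth D) b) (M.noiseVar t))
    (fun y => isoGaussianPDF_pos y _ hs)
  simp only [stepLawGiven, M.incrementLaw_eq t hs]
  -- Centring is immaterial: `y - m - v_J` is `y` minus the mean of the component `J`.
  have hloss : M.privacyLoss t θ D j b = fun y => Real.log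
      ((∑ J, M.rho t J *
        isoGaussianPDF y (M.meanIncrement t θ D (withRecord j b J)) (M.noiseVar t)) /
        isoGaussianPDF y (M.meanIncrement t θ (j.removeNth D) b) (M.noiseVar t)) := by
    ext y
    simp [privacyLoss, meanShift, isoGaussianPDF]
  rw [hloss]
  exact this

lemma exists_surrogate_event_dominating (hs : 0 < M.noiseVar t) {n : ℕ} (θ : Fin N → Param p)
    (D : Fin (n + 1) → X) (j : Fin (n + 1)) (b : Fin N → Fin n → Bool) (S : Set (Param p))
    (hS : MeasurableSet S) :
    ∃ S', MeasurableSet S' ∧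
      (M.incrementLaw t θ (j.removeNth D) b).real S = (M.surrogateLaw t).real S' ∧
      (M.stepLawGiven t θ D j b).real S ≤ (M.surrogateMixture t).real S' := by
  obtain ⟨S', hS', hQ, hP⟩ :=
    exists_real_event_dominating (M.meanIncrement t θ (j.removeNth D) b) hs hS
  refine ⟨S', hS', by rw [M.incrementLaw_eq t hs, hQ, surrogateLaw], ?_⟩
  rw [stepLawGiven, surrogateMixture, measureReal_sum_smul (M.rho_nonneg t),
    measureReal_sum_smul (M.rho_nonneg t)]
  refine Finset.sum_le_sum fun J _ => mul_le_mul_of_nonneg_left ?_ (M.rho_nonneg t J)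
  have := hP _ _ (M.norm_meanShift_le t θ D j b J)
  rwa [meanShift, add_sub_cancel, ← M.incrementLaw_eq t hs] at this

lemma stepLaw_absolutelyContinuous (hs : 0 < M.noiseVar t) {n k : ℕ} (θ : Fin N → Param p)
    (D : Fin n → X) (D' : Fin k → X) : M.stepLaw t θ D ≪ M.stepLaw t θ D' := by
  simp only [stepLaw, M.incrementLaw_eq t hs]
  exact absolutelyContinuous_mixture (M.selectionProb_nonneg t)
    (fun _ => measurable_isoGaussianPDF _ _) (fun _ y => (isoGaussianPDF_pos y _ hs).le)
    (M.selectionProb_nonneg t) (M.sum_selectionProb t k)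
    (fun _ => measurable_isoGaussianPDF _ _) (fun _ y => isoGaussianPDF_pos y _ hs)

end LinMixDPSGD

end

theorem mainTheorem5 {N p T n : ℕ} {X : Type*} (M : LinMixDPSGD N p T X) (t : Fin T)
    (hs : 0 < M.noiseVar t) (θ : Fin N → Param p) (D : Fin (n + 1) → X) (j : Fin (n + 1))
    (ε : ℝ) (hε : 0 ≤ ε) :
    Integrable (fun z => Real.exp (M.surrogateLoss t z)) (M.surrogateLaw t) ∧
    -- given the past iterates and the selection of the other records
    (∀ b : Fin N → Fin n → Bool,
      let P := M.stepLawGiven t θ D j b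
      let Q := M.incrementLaw t θ (j.removeNth D) b
      let L := M.privacyLoss t θ D j b
      llr P Q =ᵐ[Q] L ∧
      Integrable (fun y => Real.exp (L y)) Q ∧
      hockeyStick ε P Q = expectedExcess Q L ε ∧
      expectedExcess Q L ε ≤ expectedExcess (M.surrogateLaw t) (M.surrogateLoss t) ε ∧
      hockeyStick ε Q P = expectedDeficit Q L ε ∧
      expectedDeficit Q L ε ≤ expectedDeficit (M.surrogateLaw t) (M.surrogateLoss t) ε) ∧
    -- given the past iterates only
    (let P := M.stepLaw t θ D
      let Q := M.stepLaw t θ (j.removeNth D)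
      let L := llr P Q
      Integrable (fun y => Real.exp (L y)) Q ∧
      hockeyStick ε P Q = expectedExcess Q L ε ∧
      expectedExcess Q L ε ≤ expectedExcess (M.surrogateLaw t) (M.surrogateLoss t) ε ∧
      hockeyStick ε Q P = expectedDeficit Q L ε ∧
      expectedDeficit Q L ε ≤ expectedDeficit (M.surrogateLaw t) (M.surrogateLoss t) ε) := by
  have hsur := M.isLogDensity_surrogateLoss t hs
  have hbounds := fun b => hockeyStick_bounds_of_dominated
    (M.exists_surrogate_event_dominating t hs θ D j b) ε
  simp only [hsur.hockeyStick_eq, hsur.hockeyStick_swap_eq] at hbounds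
  refine ⟨hsur.integrable_exp, fun b => ?_, ?_⟩
  · have h := M.isLogDensity_privacyLoss t hs θ D j b
    exact ⟨h.llr_ae_eq, h.integrable_exp, h.hockeyStick_eq ε,
      (h.hockeyStick_eq ε).ge.trans (hbounds b).1, h.hockeyStick_swap_eq ε,
      (h.hockeyStick_swap_eq ε).ge.trans (hbounds b).2⟩
  · have h := isLogDensity_llr (M.stepLaw_absolutelyContinuous t hs θ D (j.removeNth D))
      (M.stepLaw_absolutelyContinuous t hs θ (j.removeNth D) D)
    refine ⟨h.integrable_exp, h.hockeyStick_eq ε, ?_, h.hockeyStick_swap_eq ε, ?_⟩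
    -- `Q` is by definition already a mixture over `b` with these weights.
    · rw [← h.hockeyStick_eq, M.stepLaw_eq_sum_stepLawGiven t θ D j]
      exact hockeyStick_mixture_le (M.selectionProb_nonneg t) (M.sum_selectionProb t n) _ _
        fun b => (hbounds b).1
    · rw [← h.hockeyStick_swap_eq, M.stepLaw_eq_sum_stepLawGiven t θ D j]
      exact hockeyStick_mixture_le (M.selectionProb_nonneg t) (M.sum_selectionProb t n) _ _
        fun b => (hbounds b).2
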